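/- **Theorem 4.3** (Knuth commutativity of row internal insertion operators). Let $T$ be a semistandard skew tableau of shape $\lambda/\mu$ (positive integer entries, weakly increasing along rows from left to right, strictly increasing down columns), with inner border $\mu$. For a row $i$ such that adding a cell at the end of row $i$ of $\mu$ gives again a partition, the row internal insertion operator $\phi_i$ is defined on $T$: the cell $(i,\mu_i+1)$ becomes a blank cell of the inner shape, and if it carried an entry, that entry is bumped and inserted by ordinary row insertion into row $i+1$, each bumped entry being inserted into the next row, until an entry settles at the end of a row. For a word $u=u_m\cdots u_2u_1$ put $\phi_u=\phi_{u_m}\cdots\phi_{u_2}\phi_{u_1}$ ($\phi_{u_1}$ acting first; $\phi_\emptyset=\mathrm{id}$). The standard order of the boxes of a semistandard skew tableau $U$ is by increasing entry, equal entries being ordered from left to right. The companion word of $U$ is $R(U)=u_{|U|}\cdots u_2u_1$, where $u_p$ is the row index of the $p$-th box of $U$ in the standard order. An internal insertion order word of $T$ is the companion word of any semistandard skew tableau $U$ with the same inner border $\mu$ as $T$. Knuth equivalence $\equiv$ of words is generated by $xzy\equiv zxy$ for $x\le y<z$ and $yzx\equiv yxz$ for $x<y\le z$, inside words. Let $u$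 be an internal insertion order word of $T$ and let $v\equiv u$. Then (a) $v$ is an internal insertion order word of $T$; (b) $\phi_uT$ and $\phi_vT$ are defined, are semistandard skew tableaux, and $\phi_uT=\phi_vT$. Hence the $P$-tableau of the Sagan–Stanley skew RSK correspondence with empty matrix word depends only on the Knuth class of the insertion order word: if $U,V$ are semistandard skew tableaux with inner border $\mu$ and $R(U)\equiv R(V)$, then the semistandard skew tableau $P$ obtained from $T$ by successive internal insertion at the cells of $U$ in the standard order is defined and equals the one obtained in the same way from the cells of $V$. -/

import Mathlib

/-- A row-by-row description of a filling of a skew shape `λ/μ`, from top to bottom: the `i`-th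
item `(m, l)` says that the inner shape has `m = μ_i` (blank) boxes in row `i` and that the boxes
of `λ/μ` in row `i` carry, from left to right, the labels listed in `l`; thus
`λ_i = m + l.length`.  Rows and columns are indexed from `0`.  Being a (semistandard) tableau is
the predicate `SkewFilling.IsSSYT` below. -/
abbrev SkewFilling := List (ℕ × List ℕ)

namespace SkewFilling

/-- The length `μ_i` of row `i` of the inner shape (`0` below the last row). -/
def inner (T : SkewFilling) (i : ℕ) : ℕ := (T.getD i (0, [])).1

/-- The labels in row `i`, from left to right. -/
def labels (T : SkewFilling) (i : ℕ) : List ℕ := (T.getD i (0, [])).2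

/-- The length `λ_i` of row `i` of the outer shape (`0` below the last row). -/
def outer (T : SkewFilling) (i : ℕ) : ℕ := T.inner i + (T.labels i).length

/-- The box in row `i` and column `j` belongs to the skew shape `λ/μ`. -/
def HasBox (T : SkewFilling) (i j : ℕ) : Prop := T.inner i ≤ j ∧ j < T.outer i

/-- The label of the box in row `i` and column `j` (only meaningful for boxes of `λ/μ`). -/
def entry (T : SkewFilling) (i j : ℕ) : ℕ := (T.labels i).getD (j - T.inner i) 0

/-- Semistandard skew tableaux: `μ ⊆ λ` are partitions, the labels are positive integers, weakly
increasing from left to right along rows and strictly increasing from top to bottom along columns.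
The list of rows has exactly `ℓ(λ)` items (no row of the outer shape `λ` is empty), so that
equality of lists is equality of tableaux. -/
structure IsSSYT (T : SkewFilling) : Prop where
  inner_antitone : Antitone T.inner
  outer_antitone : Antitone T.outer
  row_ne_empty : ∀ i < T.length, 0 < T.outer i
  entry_pos : ∀ i j, T.HasBox i j → 0 < T.entry i j
  row_weak : ∀ i j₁ j₂, j₁ < j₂ → T.HasBox i j₁ → T.HasBox i j₂ → T.entry i j₁ ≤ T.entry i j₂
  col_strict : ∀ i₁ i₂ j, i₁ < i₂ → T.HasBox i₁ j → T.HasBox i₂ j → T.entry i₁ j < T.entry i₂ j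

/-- Two skew fillings share their inner border `μ`. -/
def SameInner (T U : SkewFilling) : Prop := ∀ i, T.inner i = U.inner i

/-! ### Standard order and companion word -/

/-- The boxes `(row, column)` of the skew shape. -/
def boxes (U : SkewFilling) : List (ℕ × ℕ) :=
  (List.range U.length).flatMap fun i =>
    (List.range (U.labels i).length).map fun t => (i, U.inner i + t)

/-- The boxes of `U` in the standard order: by increasing label, and among equal labels from left
to right.  The `p`-th box of this list (`p = 1, 2, …`) is the one that carries the number `p` in
the standardisation of `U`. -/
def standardOrder (U : SkewFilling) : List (ℕ × ℕ) :=
  U.boxes.insertionSort fun c d =>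
    U.entry c.1 c.2 < U.entry d.1 d.2 ∨ (U.entry c.1 c.2 = U.entry d.1 d.2 ∧ c.2 ≤ d.2)

/-- The companion word `R(U) = u_{|U|} ⋯ u_2 u_1`, where `u_p` is the row of the box that carries
the number `p` in the standardisation of `U`. -/
def companionWord (U : SkewFilling) : List ℕ := (U.standardOrder.map Prod.fst).reverse

/-- `u` is an internal insertion order word of `T`: the companion word of some semistandard skew
tableau with the same inner border as `T`. -/
def IsInternalInsertionOrderWord (T : SkewFilling) (u : List ℕ) : Prop :=
  ∃ U : SkewFilling, U.IsSSYT ∧ T.SameInner U ∧ U.companionWord = u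

/-! ### Row insertion and internal row insertion -/

/-- Schensted insertion of `x` into one row: `x` replaces the leftmost label greater than `x`,
which is bumped (second component), or settles at the end of the row if there is none. -/
def rowInsert (x : ℕ) : List ℕ → List ℕ × Option ℕ
  | [] => ([x], none)
  | y :: l => if x < y then (x :: l, some y) else (y :: (rowInsert x l).1, (rowInsert x l).2)

/-- Row insertion of `x` into the first of the given rows, each bumped label being inserted into
the next row, until a label settles at the end of a (possibly new) row. -/
def insertRows (x : ℕ) : SkewFilling → SkewFilling
  | [] => [(0, [x])]
  | (m, l) :: rest =>
    match rowInsert x l with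
    | (l', none) => (m, l') :: rest
    | (l', some y) => (m, l') :: insertRows y rest

/-- Turn the first box of row `i` outside the inner shape into a blank box of the inner shape, and
row insert the label that it carried, if any, into row `i + 1`. -/
def vacate : ℕ → SkewFilling → SkewFilling
  | 0, [] => [(1, [])]
  | 0, (m, []) :: rest => (m + 1, []) :: rest
  | 0, (m, x :: l) :: rest => (m + 1, l) :: insertRows x rest
  | _ + 1, [] => []
  | i + 1, r :: rest => r :: vacate i rest

/-- The cell `(i, j)` is an inner corner of `T`, filled or empty: it is the first cell of row `i`
outside the inner shape `μ`, and adjoining it to `μ` gives a partition.  (If `(i, j)` is a box of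
`λ/μ`, this says that `(i - 1, j)` and `(i, j - 1)` are not boxes of `λ/μ`.) -/
def IsInnerCorner (T : SkewFilling) (i j : ℕ) : Prop :=
  j = T.inner i ∧ (i = 0 ∨ T.inner i < T.inner (i - 1))

instance (T : SkewFilling) (i j : ℕ) : Decidable (T.IsInnerCorner i j) := by
  unfold IsInnerCorner
  infer_instance

/-- Internal row insertion of `T` at the cell `c`; undefined (`none`) unless `c` is an inner
corner. -/
def internalInsert (T : SkewFilling) (c : ℕ × ℕ) : Option SkewFilling :=
  if T.IsInnerCorner c.1 c.2 then some (vacate c.1 T) else none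

/-- The row internal insertion operator `φ_i`. -/
def phi (i : ℕ) (T : SkewFilling) : Option SkewFilling := T.internalInsert (i, T.inner i)

/-- The composite `φ_u = φ_{u_m} ⋯ φ_{u_2} φ_{u_1}` for the word `u = u_m ⋯ u_2 u_1`: the last
letter of `u` acts first. -/
def phiWord : List ℕ → SkewFilling → Option SkewFilling
  | [], T => some T
  | a :: u, T => (phiWord u T).bind (phi a)

/-- The `P`-tableau of the skew RSK correspondence with empty matrix word, for a pair `(T, U)`
sharing an inner border: internally insert `T` successively at the cells of `U` taken in the
standard order. -/
def skewRSKP (T U : SkewFilling) : Option SkewFilling :=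
  U.standardOrder.foldlM internalInsert T

end SkewFilling

/-- Elementary Knuth relations: `x z y ≡ z x y` for `x ≤ y < z` and `y z x ≡ y x z` for
`x < y ≤ z`, inside a word. -/
inductive KnuthStep : List ℕ → List ℕ → Prop
  | xzy (w₁ w₂ : List ℕ) (x y z : ℕ) (hxy : x ≤ y) (hyz : y < z) :
      KnuthStep (w₁ ++ [x, z, y] ++ w₂) (w₁ ++ [z, x, y] ++ w₂)
  | yzx (w₁ w₂ : List ℕ) (x y z : ℕ) (hxy : x < y) (hyz : y ≤ z) :
      KnuthStep (w₁ ++ [y, z, x] ++ w₂) (w₁ ++ [y, x, z] ++ w₂)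

/-- Knuth equivalence of words: the equivalence relation generated by the Knuth relations. -/
def KnuthEquiv : List ℕ → List ℕ → Prop := Relation.EqvGen KnuthStep

/-!
Record a tableau `T` with inner border `μ` by the pairs `(label, row)` of its boxes in the standard
order.  The rows form a lattice word relative to `μ`: adjoining them to `μ` one by one passes
through partitions only.  Since every lattice word is the word of rows of a standard tableau, the
internal insertion order words of `T` are the reversed lattice words relative to `μ`, a condition
that the Knuth relations preserve.

On the list of pairs, `φ_c` becomes a local rule: it runs through the list with a row number, at
first `c`, which each box of that very row increases by one while moving down itself.  Feeding the
boxes of `T` to the operators of a word `u` one after the other, a box turns `u` into another word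
and ends in some row; Knuth equivalent words are turned into Knuth equivalent words, with the same
final row of the box.  By induction on the number of boxes, `φ_u` and `φ_v` agree on `T`.
-/

namespace SkewFilling

/-! ### Lattice words relative to a partition -/

/-- The row lengths of the shape obtained from `μ` by adjoining a box to row `r`. -/
def addBox (μ : ℕ → ℕ) (r : ℕ) : ℕ → ℕ := fun i => μ i + if i = r then 1 else 0

/-- Lattice words relative to `μ`: adjoining boxes to `μ` in the rows listed in `w`, from left to
right, passes through partitions only.  Companion words are read from right to left, so this is
applied to their reverses. -/
def IsLattice (μ : ℕ → ℕ) (w : List ℕ) : Prop := ∀ a, a <+: w → Antitone (a.foldl addBox μ)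

variable {μ : ℕ → ℕ}

theorem addBox_comm (μ : ℕ → ℕ) (r s : ℕ) : addBox (addBox μ r) s = addBox (addBox μ s) r :=
  funext fun _ => add_right_comm _ _ _

theorem foldl_addBox_apply (μ : ℕ → ℕ) (w : List ℕ) (i : ℕ) :
    w.foldl addBox μ i = μ i + w.count i := by
  induction w generalizing μ with
  | nil => rfl
  | cons r w ih =>
    simp only [List.foldl_cons, ih, addBox, List.count_cons, beq_iff_eq, eq_comm (a := i)]
    omega

theorem antitone_addBox_iff (h : Antitone μ) {r : ℕ} :
    Antitone (addBox μ r) ↔ r = 0 ∨ μ r < μ (r - 1) := by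
  constructor
  · intro h'
    have hr := h' (Nat.sub_le r 1)
    grind [addBox]
  · intro h'
    refine antitone_nat_of_succ_le fun n => ?_
    have hn := h (Nat.le_succ n)
    grind [addBox]

theorem IsLattice.antitone {w : List ℕ} (h : IsLattice μ w) : Antitone μ :=
  h [] List.nil_prefix

theorem isLattice_nil : IsLattice μ [] ↔ Antitone μ := by
  simp [IsLattice, List.prefix_nil]

theorem isLattice_cons {r : ℕ} {w : List ℕ} :
    IsLattice μ (r :: w) ↔ Antitone μ ∧ IsLattice (addBox μ r) w := by
  simp only [IsLattice, List.prefix_cons_iff, forall_eq_or_imp, forall_exists_index, and_imp,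
    List.foldl_nil]
  refine and_congr_right fun _ => ⟨fun h a ha => h _ a rfl ha, ?_⟩
  rintro h _ a rfl ha
  exact h a ha

theorem isLattice_append {w w' : List ℕ} :
    IsLattice μ (w ++ w') ↔ IsLattice μ w ∧ IsLattice (w.foldl addBox μ) w' := by
  induction w generalizing μ with
  | nil => exact ⟨fun h => ⟨isLattice_nil.2 h.antitone, h⟩, fun h => h.2⟩
  | cons r w ih => simp only [List.cons_append, isLattice_cons, ih, List.foldl_cons, and_assoc]

theorem antitone_addBox_of_lt {x z : ℕ} (hxz : x < z) (h : Antitone μ)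
    (h' : Antitone (addBox (addBox μ x) z)) : Antitone (addBox μ x) := by
  rw [antitone_addBox_iff h]
  have hx := h' (Nat.sub_le x 1)
  grind [addBox]

theorem antitone_addBox_of_gt {x z : ℕ} (hxz : x < z) (h : Antitone μ)
    (h' : Antitone (addBox (addBox μ x) z)) (hcol : z = x + 1 → μ z < μ x) :
    Antitone (addBox μ z) := by
  rw [antitone_addBox_iff h]
  have hz := h' (Nat.sub_le z 1)
  grind [addBox]

theorem isLattice_cons_cons_comm {x z : ℕ} {w : List ℕ}
    (h : Antitone μ → IsLattice (addBox (addBox μ x) z) w →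
      Antitone (addBox μ x) ∧ Antitone (addBox μ z)) :
    IsLattice μ (x :: z :: w) ↔ IsLattice μ (z :: x :: w) := by
  simp only [isLattice_cons, addBox_comm μ z x]
  tauto

theorem isLattice_yzx_iff_yxz {x y z : ℕ} (hxy : x ≤ y) (hyz : y < z) {w : List ℕ} :
    IsLattice μ (y :: z :: x :: w) ↔ IsLattice μ (y :: x :: z :: w) := by
  rw [isLattice_cons, isLattice_cons (r := y)]
  refine and_congr_right fun hμ => (isLattice_cons_cons_comm fun h h' => ?_).symm
  have hcol : z = x + 1 → addBox μ y z < addBox μ y x := by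
    have := hμ (hxy.trans hyz.le)
    grind [addBox]
  exact ⟨antitone_addBox_of_lt (by omega) h h'.antitone,
    antitone_addBox_of_gt (by omega) h h'.antitone hcol⟩

theorem isLattice_xzy_iff_zxy {x y z : ℕ} (hxy : x < y) (hyz : y ≤ z) {w : List ℕ} :
    IsLattice μ (x :: z :: y :: w) ↔ IsLattice μ (z :: x :: y :: w) := by
  refine isLattice_cons_cons_comm fun h h' => ?_
  rw [isLattice_cons] at h'
  have hcol : z = x + 1 → μ z < μ x := by
    have := h'.2.antitone (hxy.trans_le hyz).le
    grind [addBox]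
  exact ⟨antitone_addBox_of_lt (by omega) h h'.1, antitone_addBox_of_gt (by omega) h h'.1 hcol⟩

/-! ### Internal insertion on standard readings -/

section Reading

variable {α : Type*}

/-- The local rule of internal insertion: the row of a box of row `a` after it has met a box of
row `b`.  Boxes in different rows pass each other, of two boxes in the same row both move down. -/
def pushRow (a b : ℕ) : ℕ := if a = b then a + 1 else a

/-- The action of `φ_c` on the list of pairs `(label, row)` of the boxes of a tableau in the
standard order: the first box in row `c` moves to row `c + 1`, then the next box in row `c + 1`
moves to row `c + 2`, and so on. -/
def phiReading : ℕ → List (α × ℕ) → List (α × ℕ)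
  | _, [] => []
  | c, (v, r) :: t => (v, pushRow r c) :: phiReading (pushRow c r) t

/-- The action of `φ_u` on the list of pairs `(label, row)`: the last letter of `u` acts first. -/
def phiWordReading (u : List ℕ) (t : List (α × ℕ)) : List (α × ℕ) := u.foldr phiReading t

/-- The word `u`, from its last letter on, meets a box of row `r`: the resulting word and the
resulting row of the box. -/
def meetBox : List ℕ → ℕ → List ℕ × ℕ
  | [], r => ([], r)
  | a :: u, r => (pushRow a (meetBox u r).2 :: (meetBox u r).1, pushRow (meetBox u r).2 a)

theorem pushRow_self (a : ℕ) : pushRow a a = a + 1 := if_pos rfl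

theorem pushRow_of_ne {a b : ℕ} (h : a ≠ b) : pushRow a b = a := if_neg h

theorem phiWordReading_nil (u : List ℕ) : phiWordReading u ([] : List (α × ℕ)) = [] := by
  induction u with
  | nil => rfl
  | cons a u ih => exact congrArg (phiReading a) ih

theorem phiWordReading_cons (u : List ℕ) (v : α) (r : ℕ) (t : List (α × ℕ)) :
    phiWordReading u ((v, r) :: t) =
      (v, (meetBox u r).2) :: phiWordReading (meetBox u r).1 t := by
  induction u with
  | nil => rfl
  | cons a u ih => exact congrArg (phiReading a) ih

theorem meetBox_append (u w : List ℕ) (r : ℕ) :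
    meetBox (u ++ w) r = ((meetBox u (meetBox w r).2).1 ++ (meetBox w r).1,
      (meetBox u (meetBox w r).2).2) := by
  induction u with
  | nil => rfl
  | cons a u ih => simp only [List.cons_append, meetBox, ih]

theorem addBox_addBox_pushRow (μ : ℕ → ℕ) (c r : ℕ) :
    addBox (addBox μ c) (pushRow r c) = addBox (addBox μ r) (pushRow c r) := by
  rcases eq_or_ne c r with rfl | h
  · rfl
  · rw [pushRow_of_ne h, pushRow_of_ne h.symm, addBox_comm]

theorem antitone_addBox_pushRow {c r : ℕ} (hμ : Antitone μ) (hc : Antitone (addBox μ c))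
    (hr : Antitone (addBox μ r)) : Antitone (addBox (addBox μ r) (pushRow c r)) := by
  rw [antitone_addBox_iff hr]
  rcases eq_or_ne c r with rfl | h
  · have := hμ (Nat.le_succ c)
    grind [addBox, pushRow_self]
  · rw [antitone_addBox_iff hμ] at hc
    grind [addBox, pushRow_of_ne]

theorem IsLattice.phiReading {t : List (α × ℕ)} {c : ℕ} (h : IsLattice μ (t.map Prod.snd))
    (hc : Antitone (addBox μ c)) :
    IsLattice (addBox μ c) ((phiReading c t).map Prod.snd) := by
  induction t generalizing μ c with
  | nil => exact isLattice_nil.2 hc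
  | cons p t ih =>
    obtain ⟨v, r⟩ := p
    rw [List.map_cons, isLattice_cons] at h
    rw [SkewFilling.phiReading, List.map_cons, isLattice_cons, addBox_addBox_pushRow]
    exact ⟨hc, ih h.2 (antitone_addBox_pushRow h.1 hc h.2.antitone)⟩

theorem map_fst_phiReading (c : ℕ) (t : List (α × ℕ)) :
    (phiReading c t).map Prod.fst = t.map Prod.fst := by
  induction t generalizing c with
  | nil => rfl
  | cons p t ih => exact congrArg (p.1 :: ·) (ih _)

end Reading

end SkewFilling

/-! ### Invariants of Knuth equivalence -/

section Knuth

open SkewFilling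

namespace KnuthStep

variable {u v : List ℕ}

theorem append_append (h : KnuthStep u v) (a b : List ℕ) :
    KnuthStep (a ++ u ++ b) (a ++ v ++ b) := by
  cases h with
  | xzy w₁ w₂ x y z hxy hyz =>
    simpa only [List.append_assoc] using KnuthStep.xzy (a ++ w₁) (w₂ ++ b) x y z hxy hyz
  | yzx w₁ w₂ x y z hxy hyz =>
    simpa only [List.append_assoc] using KnuthStep.yzx (a ++ w₁) (w₂ ++ b) x y z hxy hyz

theorem perm (h : KnuthStep u v) : u.Perm v := by
  cases h with
  | xzy w₁ w₂ x y z =>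
    exact ((List.Perm.swap z x [y]).append_left w₁).append_right w₂
  | yzx w₁ w₂ x y z =>
    exact (((List.Perm.swap x z []).cons y).append_left w₁).append_right w₂

theorem isLattice_reverse_iff (h : KnuthStep u v) (μ : ℕ → ℕ) :
    IsLattice μ u.reverse ↔ IsLattice μ v.reverse := by
  cases h with
  | xzy w₁ w₂ x y z hxy hyz =>
    simpa [isLattice_append] using fun _ => isLattice_yzx_iff_yxz hxy hyz
  | yzx w₁ w₂ x y z hxy hyz =>
    simpa [isLattice_append] using fun _ => isLattice_xzy_iff_zxy hxy hyz

theorem meetBox_xzy {x y z : ℕ} (hxy : x ≤ y) (hyz : y < z) (r : ℕ) :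
    (meetBox [x, z, y] r).2 = (meetBox [z, x, y] r).2 ∧
      KnuthStep (meetBox [x, z, y] r).1 (meetBox [z, x, y] r).1 := by
  have key {a b c : ℕ} (hab : a ≤ b) (hbc : b < c) : KnuthStep [a, c, b] [c, a, b] :=
    KnuthStep.xzy [] [] a b c hab hbc
  simp only [meetBox]
  simp only [pushRow]
  split_ifs <;> first
    | omega
    | exact ⟨by omega, key (by omega) (by omega)⟩

theorem meetBox_yzx {x y z : ℕ} (hxy : x < y) (hyz : y ≤ z) (r : ℕ) :
    (meetBox [y, z, x] r).2 = (meetBox [y, x, z] r).2 ∧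
      KnuthStep (meetBox [y, z, x] r).1 (meetBox [y, x, z] r).1 := by
  have key {a b c : ℕ} (hab : a < b) (hbc : b ≤ c) : KnuthStep [b, c, a] [b, a, c] :=
    KnuthStep.yzx [] [] a b c hab hbc
  -- Here, and only here, the relation turns into one of the other kind.
  by_cases hcross : r = x ∧ y = x + 1 ∧ z = x + 1
  · obtain ⟨rfl, rfl, rfl⟩ := hcross
    simpa [meetBox, pushRow] using
      KnuthStep.xzy [] [] (r + 1) (r + 1) (r + 2) le_rfl (by omega)
  · simp only [meetBox]
    simp only [pushRow]
    split_ifs <;> first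
      | omega
      | exact ⟨by omega, key (by omega) (by omega)⟩

theorem meetBox_append_append (h : ∀ r, (meetBox u r).2 = (meetBox v r).2 ∧
      KnuthStep (meetBox u r).1 (meetBox v r).1) (a b : List ℕ) (r : ℕ) :
    (meetBox (a ++ u ++ b) r).2 = (meetBox (a ++ v ++ b) r).2 ∧
      KnuthStep (meetBox (a ++ u ++ b) r).1 (meetBox (a ++ v ++ b) r).1 := by
  obtain ⟨hrow, hword⟩ := h (meetBox b r).2
  simp only [meetBox_append, hrow, true_and]
  simpa only [List.append_assoc] using hword.append_append _ _

theorem meetBox (h : KnuthStep u v) (r : ℕ) :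
    (meetBox u r).2 = (meetBox v r).2 ∧ KnuthStep (meetBox u r).1 (meetBox v r).1 := by
  cases h with
  | xzy w₁ w₂ x y z hxy hyz => exact meetBox_append_append (meetBox_xzy hxy hyz) w₁ w₂ r
  | yzx w₁ w₂ x y z hxy hyz => exact meetBox_append_append (meetBox_yzx hxy hyz) w₁ w₂ r

theorem phiWordReading_eq {α : Type*} (h : KnuthStep u v) (t : List (α × ℕ)) :
    phiWordReading u t = phiWordReading v t := by
  induction t generalizing u v with
  | nil => rw [phiWordReading_nil, phiWordReading_nil]
  | cons p t ih =>
    obtain ⟨hrow, hword⟩ := h.meetBox p.2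
    rw [phiWordReading_cons, phiWordReading_cons, hrow, ih hword]

end KnuthStep

namespace KnuthEquiv

variable {u v : List ℕ}

theorem map_eq {β : Type*} {f : List ℕ → β} (hf : ∀ u v, KnuthStep u v → f u = f v)
    (h : KnuthEquiv u v) : f u = f v := by
  induction h with
  | rel u v h => exact hf u v h
  | refl => rfl
  | symm _ _ _ ih => exact ih.symm
  | trans _ _ _ _ _ ih ih' => exact ih.trans ih'

theorem perm (h : KnuthEquiv u v) : u.Perm v :=
  Multiset.coe_eq_coe.1 (h.map_eq fun _ _ h => Multiset.coe_eq_coe.2 h.perm)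

theorem isLattice_reverse_iff (h : KnuthEquiv u v) (μ : ℕ → ℕ) :
    IsLattice μ u.reverse ↔ IsLattice μ v.reverse :=
  iff_of_eq (h.map_eq (f := fun w => IsLattice μ w.reverse)
    fun _ _ h => propext (h.isLattice_reverse_iff μ))

theorem phiWordReading_eq {α : Type*} (h : KnuthEquiv u v) (t : List (α × ℕ)) :
    phiWordReading u t = phiWordReading v t :=
  h.map_eq (f := fun w => phiWordReading w t) fun _ _ h => h.phiWordReading_eq t

end KnuthEquiv

end Knuth

namespace SkewFilling

/-! ### Rows of a standard reading -/

section Rows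

variable {α : Type*}

/-- The standard order on pairs `(label, row)`.  Among equal labels of a semistandard tableau, the
boxes from left to right are the boxes from bottom to top. -/
def StandardLE [LT α] (p q : α × ℕ) : Prop := p.1 < q.1 ∨ p.1 = q.1 ∧ q.2 ≤ p.2

/-- The labels of the boxes in row `i`, from left to right. -/
def rowLabels (t : List (α × ℕ)) (i : ℕ) : List α := (t.filter fun p => p.2 = i).map Prod.fst

instance [Preorder α] : IsTrans (α × ℕ) StandardLE where
  trans p q r := by
    rintro (h | ⟨h, hr⟩) (h' | ⟨h', hr'⟩)
    · exact Or.inl (h.trans h')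
    · exact Or.inl (h' ▸ h)
    · exact Or.inl (h ▸ h')
    · exact Or.inr ⟨h.trans h', hr'.trans hr⟩

theorem StandardLE.antisymm [Preorder α] {p q : α × ℕ} (h : StandardLE p q)
    (h' : StandardLE q p) : p = q := by
  rcases h with h | ⟨h, hr⟩ <;> rcases h' with h' | ⟨h', hr'⟩
  · exact (lt_asymm h h').elim
  · exact (h.ne' h').elim
  · exact (h'.ne' h).elim
  · exact Prod.ext h (hr'.antisymm hr)

theorem StandardLE.fst_le [Preorder α] {p q : α × ℕ} (h : StandardLE p q) : p.1 ≤ q.1 :=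
  h.elim le_of_lt fun h => h.1.le

theorem StandardLE.fst_lt [LT α] {p q : α × ℕ} (h : StandardLE p q) (hr : p.2 < q.2) :
    p.1 < q.1 :=
  h.resolve_right fun h => hr.not_ge h.2

theorem rowLabels_append (t t' : List (α × ℕ)) (i : ℕ) :
    rowLabels (t ++ t') i = rowLabels t i ++ rowLabels t' i := by simp [rowLabels]

theorem rowLabels_cons_self (v : α) (i : ℕ) (t : List (α × ℕ)) :
    rowLabels ((v, i) :: t) i = v :: rowLabels t i := by simp [rowLabels]

theorem rowLabels_cons_of_ne {r i : ℕ} (h : r ≠ i) (v : α) (t : List (α × ℕ)) :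
    rowLabels ((v, r) :: t) i = rowLabels t i := by simp [rowLabels, h]

theorem mem_rowLabels {t : List (α × ℕ)} {i : ℕ} {v : α} : v ∈ rowLabels t i ↔ (v, i) ∈ t := by
  simp [rowLabels]

theorem length_rowLabels (t : List (α × ℕ)) (i : ℕ) :
    (rowLabels t i).length = (t.map Prod.snd).count i := by
  rw [rowLabels, List.length_map, List.count, List.countP_map, List.countP_eq_length_filter]
  rfl

theorem count_rowLabels [DecidableEq α] (t : List (α × ℕ)) (v : α) (i : ℕ) :
    (rowLabels t i).count v = t.count (v, i) := by
  rw [rowLabels, List.count, List.countP_map, List.countP_filter]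
  exact List.countP_congr fun p _ => by simp [Prod.ext_iff]

theorem exists_eq_append_cons_of_rowLabels_eq {t : List (α × ℕ)} {i : ℕ} {v : α} {a b : List α}
    (h : rowLabels t i = a ++ v :: b) :
    ∃ t₁ t₂, t = t₁ ++ (v, i) :: t₂ ∧ rowLabels t₁ i = a ∧ rowLabels t₂ i = b := by
  obtain ⟨s₁, s, hs, rfl, hvb⟩ := List.map_eq_append_iff.1 h
  obtain ⟨⟨w, r⟩, s₂, rfl, rfl, rfl⟩ := List.map_eq_cons_iff.1 hvb
  obtain ⟨t₁, t', rfl, rfl, ht'⟩ := List.filter_eq_append_iff.1 hs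
  obtain ⟨t₂, t₃, rfl, ht₂, hr, rfl⟩ := List.filter_eq_cons_iff.1 ht'
  obtain rfl : r = i := by simpa using hr
  refine ⟨t₁ ++ t₂, t₃, (List.append_assoc ..).symm, ?_, rfl⟩
  rw [rowLabels, List.filter_append, List.filter_eq_nil_iff.2 ht₂, List.append_nil]

theorem eq_of_rowLabels_eq [Preorder α] {t t' : List (α × ℕ)} (ht : t.Pairwise StandardLE)
    (ht' : t'.Pairwise StandardLE) (h : ∀ i, rowLabels t i = rowLabels t' i) : t = t' := by
  classical
  refine List.Perm.eq_of_pairwise (fun _ _ _ _ => StandardLE.antisymm) ht ht' ?_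
  refine List.perm_iff_count.2 fun ⟨v, i⟩ => ?_
  rw [← count_rowLabels, h, count_rowLabels]

theorem pushRow_le_pushRow {r r' : ℕ} (h : r' ≤ r) (c : ℕ) :
    pushRow r' (pushRow c r) ≤ pushRow r c := by
  unfold pushRow
  split_ifs <;> omega

theorem pairwise_phiReading [Preorder α] {t : List (α × ℕ)} (h : t.Pairwise StandardLE) (c : ℕ) :
    (phiReading c t).Pairwise StandardLE := by
  rw [← List.isChain_iff_pairwise] at h ⊢
  induction t generalizing c with
  | nil => exact List.isChain_nil
  | cons p t ih =>
    cases t with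
    | nil => exact List.isChain_singleton _
    | cons q t =>
      rw [List.isChain_cons_cons] at h
      exact List.isChain_cons_cons.2
        ⟨h.1.imp_right (And.imp_right fun h => pushRow_le_pushRow h c), ih h.2 _⟩

theorem phiReading_append_of_rowLabels_eq_nil {t : List (α × ℕ)} {c : ℕ}
    (h : rowLabels t c = []) (t' : List (α × ℕ)) :
    phiReading c (t ++ t') = t ++ phiReading c t' := by
  induction t with
  | nil => rfl
  | cons p t ih =>
    obtain ⟨v, r⟩ := p
    have hr : r ≠ c := by
      rintro rfl
      simp [rowLabels_cons_self] at h
    rw [rowLabels_cons_of_ne hr] at h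
    rw [List.cons_append, phiReading, pushRow_of_ne hr, pushRow_of_ne hr.symm, ih h,
      List.cons_append]

theorem phiReading_of_rowLabels_eq_nil {t : List (α × ℕ)} {c : ℕ} (h : rowLabels t c = []) :
    phiReading c t = t := by
  simpa [phiReading] using phiReading_append_of_rowLabels_eq_nil h []

theorem phiReading_append_cons {t t' : List (α × ℕ)} {c : ℕ} {v : α} (h : rowLabels t c = []) :
    phiReading c (t ++ (v, c) :: t') = t ++ (v, c + 1) :: phiReading (c + 1) t' := by
  rw [phiReading_append_of_rowLabels_eq_nil h, phiReading, pushRow_self]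

theorem rowLabels_phiReading_of_lt {t : List (α × ℕ)} {c i : ℕ} (h : i < c) :
    rowLabels (phiReading c t) i = rowLabels t i := by
  induction t generalizing c with
  | nil => rfl
  | cons p t ih =>
    obtain ⟨v, r⟩ := p
    rw [phiReading]
    rcases eq_or_ne r c with rfl | hr
    · rw [pushRow_self, rowLabels_cons_of_ne (by omega), rowLabels_cons_of_ne (by omega),
        ih (by omega)]
    · rw [pushRow_of_ne hr, pushRow_of_ne hr.symm]
      rcases eq_or_ne r i with rfl | hi
      · rw [rowLabels_cons_self, rowLabels_cons_self, ih h]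
      · rw [rowLabels_cons_of_ne hi, rowLabels_cons_of_ne hi, ih h]

end Rows

/-! ### Semistandard tableaux and their standard readings -/

/-- Every row of the outer shape has a box. -/
def NoEmptyRow (T : SkewFilling) : Prop := ∀ r ∈ T, 0 < r.1 + r.2.length

/-- `t` lists the pairs `(label, row)` of the boxes of a semistandard tableau `T` in the standard
order; see `IsStandardReading.isSSYT` and `IsSSYT.isStandardReading`. -/
structure IsStandardReading (T : SkewFilling) (t : List (ℕ × ℕ)) : Prop where
  labels_eq : ∀ i, T.labels i = rowLabels t i
  sorted : t.Pairwise StandardLE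
  lattice : IsLattice T.inner (t.map Prod.snd)
  pos : ∀ p ∈ t, 0 < p.1
  noEmptyRow : T.NoEmptyRow

theorem inner_of_length_le {T : SkewFilling} {i : ℕ} (h : T.length ≤ i) : T.inner i = 0 := by
  rw [inner, List.getD_eq_default _ _ h]

theorem outer_of_length_le {T : SkewFilling} {i : ℕ} (h : T.length ≤ i) : T.outer i = 0 := by
  rw [outer, inner, labels, List.getD_eq_default _ _ h, List.length_nil]

theorem inner_eq_getElem {T : SkewFilling} {i : ℕ} (h : i < T.length) : T.inner i = T[i].1 := by
  rw [inner, List.getD_eq_getElem _ _ h]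

theorem labels_eq_getElem {T : SkewFilling} {i : ℕ} (h : i < T.length) : T.labels i = T[i].2 := by
  rw [labels, List.getD_eq_getElem _ _ h]

theorem outer_eq_getElem {T : SkewFilling} {i : ℕ} (h : i < T.length) :
    T.outer i = T[i].1 + T[i].2.length := by
  rw [outer, inner_eq_getElem h, labels_eq_getElem h]

theorem noEmptyRow_iff {T : SkewFilling} : T.NoEmptyRow ↔ ∀ i < T.length, 0 < T.outer i := by
  rw [NoEmptyRow, List.forall_mem_iff_forall_getElem]
  exact forall₂_congr fun i hi => by rw [outer_eq_getElem hi]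

theorem NoEmptyRow.lt_length_iff {T : SkewFilling} (h : T.NoEmptyRow) {i : ℕ} :
    i < T.length ↔ 0 < T.outer i := by
  refine ⟨noEmptyRow_iff.1 h i, fun hi => ?_⟩
  by_contra! hlen
  exact hi.ne' (outer_of_length_le hlen)

theorem NoEmptyRow.ext {T U : SkewFilling} (hT : T.NoEmptyRow) (hU : U.NoEmptyRow)
    (hi : T.inner = U.inner) (hl : T.labels = U.labels) : T = U := by
  have hlt (i : ℕ) : i < T.length ↔ i < U.length := by
    rw [hT.lt_length_iff, hU.lt_length_iff, outer, outer, hi, hl]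
  have hlen : T.length = U.length :=
    le_antisymm (le_of_forall_lt fun i => (hlt i).1) (le_of_forall_lt fun i => (hlt i).2)
  refine List.ext_getElem hlen fun i h h' => Prod.ext ?_ ?_
  · rw [← inner_eq_getElem h, ← inner_eq_getElem h', hi]
  · rw [← labels_eq_getElem h, ← labels_eq_getElem h', hl]

theorem exists_inner_eq_labels_eq {μ : ℕ → ℕ} {l : ℕ → List ℕ}
    (hanti : Antitone fun i => μ i + (l i).length) (hzero : ∃ n, μ n + (l n).length = 0) :
    ∃ U : SkewFilling, U.inner = μ ∧ U.labels = l ∧ U.NoEmptyRow := by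
  classical
  have hlt (i : ℕ) : i < Nat.find hzero ↔ 0 < μ i + (l i).length := by
    refine ⟨fun h => Nat.pos_of_ne_zero (Nat.find_min hzero h), fun h => ?_⟩
    by_contra! hle
    exact h.not_ge ((hanti hle).trans (Nat.find_spec hzero).le)
  let U : SkewFilling := (List.range (Nat.find hzero)).map fun i => (μ i, l i)
  have hU (i : ℕ) : U.getD i (0, []) = (μ i, l i) := by
    by_cases hi : i < Nat.find hzero
    · simp only [U, List.getD_eq_getElem?_getD, List.getElem?_map, List.getElem?_range hi,
        Option.map_some, Option.getD_some]
    · have hempty : μ i = 0 ∧ l i = [] := by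
        rw [hlt, Nat.pos_iff_ne_zero, not_not] at hi
        exact ⟨by omega, List.length_eq_zero_iff.1 (by omega)⟩
      rw [List.getD_eq_default _ _ (by simpa [U] using hi), hempty.1, hempty.2]
  refine ⟨U, funext fun i => by rw [inner, hU], funext fun i => by rw [labels, hU], ?_⟩
  rintro r hr
  obtain ⟨i, hi, rfl⟩ := List.mem_map.1 hr
  exact (hlt i).1 (List.mem_range.1 hi)

namespace IsStandardReading

variable {T : SkewFilling} {t : List (ℕ × ℕ)}

theorem outer_eq (h : T.IsStandardReading t) :
    T.outer = (t.map Prod.snd).foldl addBox T.inner := by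
  funext i
  rw [outer, h.labels_eq, length_rowLabels, foldl_addBox_apply]

theorem exists_eq_append_cons (h : T.IsStandardReading t) {i j : ℕ} (hij : T.HasBox i j) :
    ∃ t₁ t₂, t = t₁ ++ (T.entry i j, i) :: t₂ ∧ j = T.inner i + (t₁.map Prod.snd).count i := by
  obtain ⟨hle, hlt⟩ := hij
  have hk : j - T.inner i < (rowLabels t i).length := by
    rw [outer, h.labels_eq] at hlt
    omega
  have hsplit := (List.take_append_drop (j - T.inner i) (rowLabels t i)).symm
  rw [List.drop_eq_getElem_cons hk] at hsplit
  obtain ⟨t₁, t₂, ht, ht₁, -⟩ := exists_eq_append_cons_of_rowLabels_eq hsplit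
  refine ⟨t₁, t₂, ?_, ?_⟩
  · rw [entry, h.labels_eq, List.getD_eq_getElem _ _ hk]
    exact ht
  · rw [← length_rowLabels, ht₁, List.length_take]
    omega

theorem entry_mem_of_lt {t₁ t₂ : List (ℕ × ℕ)} (h : T.IsStandardReading (t₁ ++ t₂)) {i j : ℕ}
    (hj : T.inner i ≤ j) (hj' : j < T.inner i + (t₁.map Prod.snd).count i) :
    (T.entry i j, i) ∈ t₁ := by
  rw [← length_rowLabels] at hj'
  have hk : j - T.inner i < (rowLabels t₁ i).length := by omega
  rw [← mem_rowLabels, entry, h.labels_eq, rowLabels_append, List.getD_append _ _ _ _ hk,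
    List.getD_eq_getElem _ _ hk]
  exact List.getElem_mem hk

theorem isSSYT (h : T.IsStandardReading t) : T.IsSSYT where
  inner_antitone := h.lattice.antitone
  outer_antitone := h.outer_eq ▸ h.lattice _ List.prefix_rfl
  row_ne_empty := noEmptyRow_iff.1 h.noEmptyRow
  entry_pos i j hij := by
    obtain ⟨t₁, t₂, rfl, -⟩ := h.exists_eq_append_cons hij
    exact h.pos _ (List.mem_append_right _ List.mem_cons_self)
  row_weak i j₁ j₂ hj h₁ h₂ := by
    obtain ⟨t₁, t₂, ht, hj₂⟩ := h.exists_eq_append_cons h₂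
    rw [ht] at h
    have hmem := h.entry_mem_of_lt h₁.1 (hj₂ ▸ hj)
    exact ((List.pairwise_append.1 h.sorted).2.2 _ hmem _ List.mem_cons_self).fst_le
  col_strict i₁ i₂ j hi h₁ h₂ := by
    obtain ⟨t₁, t₂, ht, hj₂⟩ := h.exists_eq_append_cons h₂
    rw [ht] at h
    -- The box in row `i₂` extends a partition, so row `i₁` reaches beyond it already.
    have hanti : Antitone (addBox ((t₁.map Prod.snd).foldl addBox T.inner) i₂) := by
      have hl := h.lattice
      rw [List.map_append, List.map_cons, isLattice_append, isLattice_cons] at hl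
      exact hl.2.2.antitone
    have hlt : j < T.inner i₁ + (t₁.map Prod.snd).count i₁ := by
      have := hanti hi.le
      simp only [addBox, foldl_addBox_apply, if_pos, if_neg hi.ne] at this
      omega
    have hmem := h.entry_mem_of_lt h₁.1 hlt
    exact ((List.pairwise_append.1 h.sorted).2.2 _ hmem _ List.mem_cons_self).fst_lt hi

end IsStandardReading

theorem exists_isStandardReading {T : SkewFilling} {t : List (ℕ × ℕ)}
    (hs : t.Pairwise StandardLE) (hl : IsLattice T.inner (t.map Prod.snd))
    (hpos : ∀ p ∈ t, 0 < p.1) : ∃ U : SkewFilling, U.inner = T.inner ∧ U.IsStandardReading t := by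
  have houter : (fun i => T.inner i + (rowLabels t i).length) =
      (t.map Prod.snd).foldl addBox T.inner := by
    funext i
    rw [length_rowLabels, foldl_addBox_apply]
  have hzero : ∃ n, T.inner n + (rowLabels t n).length = 0 := by
    refine ⟨T.length + (t.map Prod.snd).sum + 1, ?_⟩
    rw [inner_of_length_le (by omega), zero_add, length_rowLabels, List.count_eq_zero]
    intro hmem
    have := List.le_sum_of_mem hmem
    omega
  obtain ⟨U, hinner, hlabels, hU⟩ :=
    exists_inner_eq_labels_eq (houter ▸ hl _ List.prefix_rfl) hzero
  exact ⟨U, hinner, congrFun hlabels, hs, hinner ▸ hl, hpos, hU⟩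

/-! ### The standard order -/

/-- The relation by which `standardOrder` sorts the boxes `(row, column)`. -/
def BoxLE (U : SkewFilling) (c d : ℕ × ℕ) : Prop :=
  U.entry c.1 c.2 < U.entry d.1 d.2 ∨ (U.entry c.1 c.2 = U.entry d.1 d.2 ∧ c.2 ≤ d.2)

instance (U : SkewFilling) : DecidableRel U.BoxLE := fun _ _ => by
  unfold BoxLE
  infer_instance

/-- The pairs `(label, row)` of the boxes of `U` in the standard order. -/
def standardReading (U : SkewFilling) : List (ℕ × ℕ) :=
  U.standardOrder.map fun c => (U.entry c.1 c.2, c.1)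

theorem mem_boxes {U : SkewFilling} {c : ℕ × ℕ} : c ∈ U.boxes ↔ U.HasBox c.1 c.2 := by
  obtain ⟨i, j⟩ := c
  simp only [boxes, List.mem_flatMap, List.mem_range, List.mem_map, Prod.mk.injEq, HasBox]
  constructor
  · rintro ⟨i, -, k, hk, rfl, rfl⟩
    rw [outer]
    omega
  · rintro ⟨hle, hlt⟩
    have hi : i < U.length := by
      by_contra! h
      rw [outer_of_length_le h] at hlt
      omega
    rw [outer] at hlt
    exact ⟨i, hi, j - U.inner i, by omega, rfl, by omega⟩

theorem nodup_boxes (U : SkewFilling) : U.boxes.Nodup := by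
  rw [boxes, List.nodup_flatMap]
  refine ⟨fun i _ => List.nodup_range.map fun a b h => by simpa using h, ?_⟩
  refine List.nodup_range.imp fun {i i'} hne => ?_
  simp only [Function.onFun, List.Disjoint, List.mem_map]
  rintro _ ⟨_, _, rfl⟩ ⟨_, _, h⟩
  exact hne (congrArg Prod.fst h).symm

theorem perm_standardOrder (U : SkewFilling) : U.standardOrder.Perm U.boxes :=
  List.perm_insertionSort _ _

theorem mem_standardOrder {U : SkewFilling} {c : ℕ × ℕ} :
    c ∈ U.standardOrder ↔ U.HasBox c.1 c.2 := by
  rw [U.perm_standardOrder.mem_iff, mem_boxes]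

theorem nodup_standardOrder (U : SkewFilling) : U.standardOrder.Nodup :=
  U.perm_standardOrder.nodup_iff.2 U.nodup_boxes

theorem pairwise_standardOrder (U : SkewFilling) : U.standardOrder.Pairwise U.BoxLE := by
  have : Std.Total U.BoxLE := ⟨fun c d => by unfold BoxLE; omega⟩
  have : IsTrans (ℕ × ℕ) U.BoxLE := ⟨fun a b c h h' => by unfold BoxLE at *; omega⟩
  exact List.pairwise_insertionSort U.BoxLE _

theorem companionWord_eq (U : SkewFilling) :
    U.companionWord = (U.standardReading.map Prod.snd).reverse := by
  rw [companionWord, standardReading, List.map_map]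
  rfl

namespace IsSSYT

variable {U : SkewFilling}

theorem entry_le_entry (hU : U.IsSSYT) {i₁ i₂ j₁ j₂ : ℕ} (hi : i₁ ≤ i₂) (hj : j₁ ≤ j₂)
    (h₁ : U.HasBox i₁ j₁) (h₂ : U.HasBox i₂ j₂) : U.entry i₁ j₁ ≤ U.entry i₂ j₂ := by
  have hbox : U.HasBox i₁ j₂ := ⟨h₁.1.trans hj, h₂.2.trans_le (hU.outer_antitone hi)⟩
  calc U.entry i₁ j₁ ≤ U.entry i₁ j₂ := by
        rcases hj.eq_or_lt with rfl | hj
        exacts [le_rfl, hU.row_weak _ _ _ hj h₁ hbox]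
    _ ≤ U.entry i₂ j₂ := by
        rcases hi.eq_or_lt with rfl | hi
        exacts [le_rfl, (hU.col_strict _ _ _ hi hbox h₂).le]

theorem entry_lt_entry (hU : U.IsSSYT) {i₁ i₂ j₁ j₂ : ℕ} (hi : i₁ < i₂) (hj : j₁ ≤ j₂)
    (h₁ : U.HasBox i₁ j₁) (h₂ : U.HasBox i₂ j₂) : U.entry i₁ j₁ < U.entry i₂ j₂ := by
  have hbox : U.HasBox i₁ j₂ := ⟨h₁.1.trans hj, h₂.2.trans_le (hU.outer_antitone hi.le)⟩
  exact (hU.entry_le_entry le_rfl hj h₁ hbox).trans_lt (hU.col_strict _ _ _ hi hbox h₂)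

theorem filter_standardOrder (hU : U.IsSSYT) (i : ℕ) :
    U.standardOrder.filter (fun c => c.1 = i) =
      (List.range (U.labels i).length).map fun k => (i, U.inner i + k) := by
  have hmem (c : ℕ × ℕ) : c ∈ U.standardOrder.filter (fun c => c.1 = i) ↔
      U.HasBox i c.2 ∧ c.1 = i := by
    rw [List.mem_filter, mem_standardOrder, decide_eq_true_eq]
    exact ⟨fun ⟨h, hi⟩ => ⟨hi ▸ h, hi⟩, fun ⟨h, hi⟩ => ⟨hi.symm ▸ h, hi⟩⟩
  refine List.Perm.eq_of_pairwise (le := fun c d : ℕ × ℕ => c.2 ≤ d.2) ?_ ?_ ?_ ?_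
  · intro c d hc hd hcd hdc
    obtain ⟨k, -, rfl⟩ := List.mem_map.1 hd
    exact Prod.ext ((hmem c).1 hc).2 (hcd.antisymm hdc)
  · refine (U.pairwise_standardOrder.filter _).imp_of_mem ?_
    rintro ⟨_, j⟩ ⟨_, j'⟩ h h' hle
    obtain ⟨h, rfl⟩ := (hmem _).1 h
    obtain ⟨h', rfl⟩ := (hmem _).1 h'
    by_contra! hlt
    have := hU.entry_le_entry le_rfl hlt.le h' h
    dsimp only [BoxLE] at hle this
    omega
  · rw [List.pairwise_map]
    exact List.pairwise_le_range.imp fun h => Nat.add_le_add_left h _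
  · rw [List.perm_ext_iff_of_nodup (U.nodup_standardOrder.filter _)
      (List.nodup_range.map fun a b h => by simpa using h)]
    rintro ⟨r, j⟩
    rw [hmem]
    simp only [List.mem_map, List.mem_range, Prod.mk.injEq, HasBox, outer]
    constructor
    · rintro ⟨⟨hle, hlt⟩, rfl⟩
      exact ⟨j - U.inner r, by omega, rfl, by omega⟩
    · rintro ⟨k, hk, rfl, rfl⟩
      omega

theorem mem_prefix_iff (hU : U.IsSSYT) {a : List (ℕ × ℕ)} (h : a <+: U.standardOrder) (i j : ℕ) :
    (i, j) ∈ a ↔ U.inner i ≤ j ∧ j < U.inner i + (a.map Prod.fst).count i := by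
  have hcount : (a.map Prod.fst).count i = (a.filter fun c => c.1 = i).length := by
    rw [List.count, List.countP_map, List.countP_eq_length_filter]
    rfl
  have hpre := hU.filter_standardOrder i ▸ h.filter fun c : ℕ × ℕ => c.1 = i
  have hle := hpre.length_le
  rw [List.prefix_iff_eq_take, ← List.map_take, List.take_range] at hpre
  rw [List.length_map, List.length_range] at hle
  have hmem : (i, j) ∈ a ↔ (i, j) ∈ a.filter fun c => c.1 = i := by simp
  rw [hmem, hcount, hpre, min_eq_left hle]
  simp only [List.mem_map, List.mem_range, Prod.mk.injEq, List.length_map, List.length_range,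
    true_and]
  constructor
  · rintro ⟨k, hk, rfl⟩
    omega
  · rintro ⟨hj, hj'⟩
    exact ⟨j - U.inner i, by omega, by omega⟩

theorem snd_eq_of_standardOrder_eq (hU : U.IsSSYT) {a b : List (ℕ × ℕ)} {c : ℕ × ℕ}
    (h : U.standardOrder = a ++ c :: b) : c.2 = U.inner c.1 + (a.map Prod.fst).count c.1 := by
  have hc : c ∉ a := fun hc =>
    List.disjoint_of_nodup_append (h ▸ U.nodup_standardOrder) hc List.mem_cons_self
  have hle := (hU.mem_prefix_iff (a := a ++ [c]) ⟨b, by simp [h]⟩ c.1 c.2).1 (by simp)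
  have hge := mt (hU.mem_prefix_iff ⟨_, h.symm⟩ c.1 c.2).2 hc
  simp only [List.map_append, List.map_cons, List.map_nil, List.count_append,
    List.count_singleton_self] at hle
  omega

theorem mem_prefix_of_lt (hU : U.IsSSYT) {a : List (ℕ × ℕ)} (h : a <+: U.standardOrder)
    {i i' j : ℕ} (hi : i < i') (hj : U.inner i ≤ j) (hmem : (i', j) ∈ a) : (i, j) ∈ a := by
  obtain ⟨b, hab⟩ := h
  have hbox' : U.HasBox i' j := mem_standardOrder.1 (hab ▸ List.mem_append_left b hmem)
  have hbox : U.HasBox i j := ⟨hj, hbox'.2.trans_le (hU.outer_antitone hi.le)⟩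
  have hlt := hU.col_strict i i' j hi hbox hbox'
  refine (List.mem_append.1 (hab ▸ mem_standardOrder.2 hbox)).resolve_right fun hb => ?_
  have hle : U.BoxLE (i', j) (i, j) :=
    (List.pairwise_append.1 (hab ▸ U.pairwise_standardOrder)).2.2 _ hmem _ hb
  simp only [BoxLE] at hle
  omega

theorem isLattice_standardOrder (hU : U.IsSSYT) :
    IsLattice U.inner (U.standardOrder.map Prod.fst) := by
  intro w hw i i' hi
  obtain ⟨a, ha, rfl⟩ := List.prefix_map_iff.1 hw
  rcases hi.eq_or_lt with rfl | hi
  · exact le_rfl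
  rw [foldl_addBox_apply, foldl_addBox_apply]
  by_contra! hlt
  have hinner := hU.inner_antitone hi.le
  let j := U.inner i' + (a.map Prod.fst).count i' - 1
  have hmem' : (i', j) ∈ a := (hU.mem_prefix_iff ha i' j).2 (by omega)
  have hmem : (i, j) ∈ a := hU.mem_prefix_of_lt ha hi (by omega) hmem'
  have := (hU.mem_prefix_iff ha i j).1 hmem
  omega

theorem labels_eq_rowLabels (hU : U.IsSSYT) (i : ℕ) :
    U.labels i = rowLabels U.standardReading i := by
  have h : rowLabels U.standardReading i =
      (U.standardOrder.filter fun c => c.1 = i).map fun c => U.entry c.1 c.2 := by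
    simp [rowLabels, standardReading, List.filter_map, Function.comp_def]
  rw [h, hU.filter_standardOrder, List.map_map]
  refine List.ext_getElem (by simp) fun k hk hk' => ?_
  simp [entry, List.getElem?_eq_getElem hk]

theorem pairwise_standardReading (hU : U.IsSSYT) : U.standardReading.Pairwise StandardLE := by
  rw [standardReading, List.pairwise_map]
  refine U.pairwise_standardOrder.imp_of_mem fun {c d} hc hd hle => ?_
  rw [mem_standardOrder] at hc hd
  refine hle.imp_right fun ⟨heq, hcol⟩ => ⟨heq, ?_⟩
  by_contra! hrow
  exact (hU.entry_lt_entry hrow hcol hc hd).ne heq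

theorem isStandardReading (hU : U.IsSSYT) : U.IsStandardReading U.standardReading where
  labels_eq := hU.labels_eq_rowLabels
  sorted := hU.pairwise_standardReading
  lattice := by
    rw [standardReading, List.map_map]
    exact hU.isLattice_standardOrder
  pos p hp := by
    obtain ⟨c, hc, rfl⟩ := List.mem_map.1 hp
    exact hU.entry_pos _ _ (mem_standardOrder.1 hc)
  noEmptyRow := noEmptyRow_iff.2 hU.row_ne_empty

end IsSSYT

theorem IsStandardReading.eq_standardReading {U : SkewFilling} {t : List (ℕ × ℕ)}
    (h : U.IsStandardReading t) : t = U.standardReading :=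
  eq_of_rowLabels_eq h.sorted h.isSSYT.pairwise_standardReading fun i => by
    rw [← h.labels_eq, ← h.isSSYT.labels_eq_rowLabels]

theorem exists_companionWord_reverse_eq {T : SkewFilling} {w : List ℕ} (h : IsLattice T.inner w) :
    ∃ U : SkewFilling, U.IsSSYT ∧ U.inner = T.inner ∧ U.companionWord.reverse = w := by
  let t := (List.range' 1 w.length).zip w
  have hfst : t.map Prod.fst = List.range' 1 w.length := List.map_fst_zip (by simp)
  have hsnd : t.map Prod.snd = w := List.map_snd_zip (by simp)
  have hsorted : t.Pairwise StandardLE := by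
    have : (t.map Prod.fst).Pairwise (· < ·) := hfst ▸ List.pairwise_lt_range'
    exact (List.pairwise_map.1 this).imp Or.inl
  have hpos (p) (hp : p ∈ t) : 0 < p.1 :=
    (List.mem_range'_1.1 (List.of_mem_zip hp).1).1
  obtain ⟨U, hinner, hU⟩ := exists_isStandardReading hsorted (hsnd.symm ▸ h) hpos
  refine ⟨U, hU.isSSYT, hinner, ?_⟩
  rw [companionWord_eq, ← hU.eq_standardReading, hsnd, List.reverse_reverse]

theorem isInternalInsertionOrderWord_iff {T : SkewFilling} {u : List ℕ} :
    T.IsInternalInsertionOrderWord u ↔ IsLattice T.inner u.reverse := by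
  constructor
  · rintro ⟨U, hU, hTU, rfl⟩
    rw [companionWord_eq, List.reverse_reverse, funext hTU]
    exact hU.isStandardReading.lattice
  · intro h
    obtain ⟨U, hU, hinner, hword⟩ := exists_companionWord_reverse_eq h
    exact ⟨U, hU, fun i => by rw [hinner], List.reverse_injective hword⟩

/-! ### Internal insertion acts on standard readings -/

/-- The rows of `T`, from the top one on, carry the labels of the rows `k, k + 1, …` of `t`. -/
def LabelsFrom (k : ℕ) (T : SkewFilling) (t : List (ℕ × ℕ)) : Prop :=
  ∀ j, T.labels j = rowLabels t (k + j)

theorem rowInsert_of_le {x : ℕ} {l : List ℕ} (h : ∀ y ∈ l, y ≤ x) :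
    rowInsert x l = (l ++ [x], none) := by
  induction l with
  | nil => rfl
  | cons y l ih =>
    rw [List.forall_mem_cons] at h
    rw [rowInsert, if_neg h.1.not_gt, ih h.2, List.cons_append]

theorem rowInsert_append_cons {x y : ℕ} {l l' : List ℕ} (h : ∀ z ∈ l, z ≤ x) (hxy : x < y) :
    rowInsert x (l ++ y :: l') = (l ++ x :: l', some y) := by
  induction l with
  | nil => exact if_pos hxy
  | cons z l ih =>
    rw [List.forall_mem_cons] at h
    rw [List.cons_append, rowInsert, if_neg h.1.not_gt, ih h.2, List.cons_append]

theorem labelsFrom_nil {k : ℕ} {t : List (ℕ × ℕ)} :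
    LabelsFrom k [] t ↔ LabelsFrom k [(0, [])] t :=
  forall_congr' fun j => by cases j <;> rfl

theorem labelsFrom_cons {k m : ℕ} {l : List ℕ} {T : SkewFilling} {t : List (ℕ × ℕ)} :
    LabelsFrom k ((m, l) :: T) t ↔ l = rowLabels t k ∧ LabelsFrom (k + 1) T t := by
  simp only [LabelsFrom, add_assoc, add_comm 1]
  refine ⟨fun h => ⟨h 0, fun j => h (j + 1)⟩, fun h j => ?_⟩
  cases j with
  | zero => exact h.1
  | succ j => exact h.2 j

theorem labelsFrom_append_cons {k x r : ℕ} (hr : r < k) {T : SkewFilling}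
    {a b : List (ℕ × ℕ)} : LabelsFrom k T (a ++ (x, r) :: b) ↔ LabelsFrom k T (a ++ b) := by
  refine forall_congr' fun j => ?_
  rw [rowLabels_append, rowLabels_cons_of_ne (by omega), rowLabels_append]

theorem labelsFrom_insertRows_of_rowLabels_eq_nil {T : SkewFilling} {k m x : ℕ} {l : List ℕ}
    {a b : List (ℕ × ℕ)} (hT : LabelsFrom (k + 1) ((m, l) :: T) (a ++ (x, k) :: b))
    (ha : ∀ v ∈ rowLabels a (k + 1), v ≤ x) (hb : rowLabels b (k + 1) = []) :
    LabelsFrom (k + 1) (insertRows x ((m, l) :: T))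
      (a ++ (x, k + 1) :: phiReading (k + 1) b) := by
  obtain ⟨hl, hrest⟩ := labelsFrom_cons.1 hT
  rw [rowLabels_append, rowLabels_cons_of_ne (lt_add_one k).ne, hb, List.append_nil] at hl
  rw [insertRows, hl, rowInsert_of_le ha, phiReading_of_rowLabels_eq_nil hb, labelsFrom_cons,
    rowLabels_append, rowLabels_cons_self, hb, labelsFrom_append_cons (lt_add_one (k + 1))]
  exact ⟨rfl, (labelsFrom_append_cons (by omega)).1 hrest⟩

theorem labelsFrom_insertRows {T : SkewFilling} {k x : ℕ} {a b : List (ℕ × ℕ)}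
    (hT : LabelsFrom (k + 1) T (a ++ (x, k) :: b))
    (hs : (a ++ (x, k) :: b).Pairwise StandardLE) :
    LabelsFrom (k + 1) (insertRows x T) (a ++ (x, k + 1) :: phiReading (k + 1) b) := by
  have hle {x k : ℕ} {a b : List (ℕ × ℕ)} (hs : (a ++ (x, k) :: b).Pairwise StandardLE) :
      ∀ v ∈ rowLabels a (k + 1), v ≤ x := fun v hv =>
    ((List.pairwise_append.1 hs).2.2 _ (mem_rowLabels.1 hv) _ List.mem_cons_self).fst_le
  induction T generalizing k x a b with
  | nil =>
    rw [labelsFrom_nil] at hT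
    have hb := (labelsFrom_cons.1 hT).1
    rw [rowLabels_append, rowLabels_cons_of_ne (lt_add_one k).ne, eq_comm,
      List.append_eq_nil_iff] at hb
    exact labelsFrom_insertRows_of_rowLabels_eq_nil hT (hle hs) hb.2
  | cons r T ih =>
    obtain ⟨m, l⟩ := r
    obtain ⟨hl, hrest⟩ := labelsFrom_cons.1 hT
    rw [rowLabels_append, rowLabels_cons_of_ne (lt_add_one k).ne] at hl
    rcases hb : rowLabels b (k + 1) with - | ⟨y, l'⟩
    · exact labelsFrom_insertRows_of_rowLabels_eq_nil hT (hle hs) hb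
    · obtain ⟨b₁, b₂, rfl, hb₁, hb₂⟩ := exists_eq_append_cons_of_rowLabels_eq (a := []) hb
      have hxy : x < y :=
        (List.rel_of_pairwise_cons (List.pairwise_append.1 hs).2.1
          (List.mem_append_right b₁ List.mem_cons_self)).fst_lt (lt_add_one k)
      rw [hb] at hl
      rw [insertRows, hl, rowInsert_append_cons (hle hs) hxy, phiReading_append_cons hb₁,
        labelsFrom_cons]
      constructor
      · rw [rowLabels_append, rowLabels_cons_self, rowLabels_append, hb₁,
          rowLabels_cons_of_ne (by omega), rowLabels_phiReading_of_lt (by omega), hb₂,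
          List.nil_append]
      · -- The bumped `(y, k + 1)` now plays the part of `(x, k)`.
        have hreg (q : ℕ × ℕ) (c : List (ℕ × ℕ)) :
            a ++ (x, k) :: (b₁ ++ q :: c) = (a ++ (x, k) :: b₁) ++ q :: c := by simp
        rw [hreg] at hrest hs
        have := ih hrest hs
        rw [← hreg, labelsFrom_append_cons (by omega)] at this
        exact (labelsFrom_append_cons (by omega)).2 this

theorem labelsFrom_vacate {T : SkewFilling} {k i : ℕ} {t : List (ℕ × ℕ)}
    (hT : LabelsFrom k T t) (hs : t.Pairwise StandardLE) (hi : i ≤ T.length) :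
    LabelsFrom k (vacate i T) (phiReading (k + i) t) := by
  induction i generalizing T k with
  | zero =>
    have hempty {m : ℕ} {T : SkewFilling} (hT : LabelsFrom k ((m, []) :: T) t) :
        LabelsFrom k ((m + 1, []) :: T) (phiReading k t) := by
      rw [labelsFrom_cons] at hT
      rw [phiReading_of_rowLabels_eq_nil hT.1.symm]
      exact labelsFrom_cons.2 hT
    rcases T with - | ⟨⟨m, - | ⟨x, l⟩⟩, T⟩
    · exact hempty (labelsFrom_nil.1 hT)
    · exact hempty hT
    · obtain ⟨hl, hrest⟩ := labelsFrom_cons.1 hT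
      obtain ⟨t₁, t₂, rfl, ht₁, ht₂⟩ := exists_eq_append_cons_of_rowLabels_eq (a := []) hl.symm
      rw [add_zero, phiReading_append_cons ht₁, vacate, labelsFrom_cons]
      refine ⟨?_, labelsFrom_insertRows hrest hs⟩
      rw [rowLabels_append, ht₁, rowLabels_cons_of_ne (by omega),
        rowLabels_phiReading_of_lt (by omega), ht₂, List.nil_append]
  | succ i ih =>
    rcases T with - | ⟨⟨m, l⟩, T⟩
    · simp at hi
    · rw [labelsFrom_cons] at hT
      rw [vacate, labelsFrom_cons, rowLabels_phiReading_of_lt (by omega), add_comm i, ← add_assoc]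
      exact ⟨hT.1, ih hT.2 (by simpa using hi)⟩

theorem inner_insertRows (x : ℕ) (T : SkewFilling) : (insertRows x T).inner = T.inner := by
  funext j
  induction T generalizing x j with
  | nil => cases j <;> rfl
  | cons r T ih =>
    rw [insertRows]
    rcases rowInsert x r.2 with ⟨l', - | y⟩ <;> cases j
    exacts [rfl, rfl, rfl, ih _ _]

theorem inner_vacate {T : SkewFilling} {i : ℕ} (hi : i ≤ T.length) :
    (vacate i T).inner = addBox T.inner i := by
  funext j
  induction i generalizing T j with
  | zero =>
    rcases T with - | ⟨⟨m, - | ⟨x, l⟩⟩, T⟩ <;> cases j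
    exacts [rfl, rfl, rfl, rfl, rfl, congrFun (inner_insertRows x T) _]
  | succ i ih =>
    rcases T with - | ⟨r, T⟩
    · simp at hi
    · cases j with
      | zero => simp [vacate, addBox, inner]
      | succ j =>
        have := ih (T := T) (by simpa using hi) j
        simpa [vacate, addBox, inner] using this

theorem length_rowInsert_pos (x : ℕ) (l : List ℕ) : 0 < (rowInsert x l).1.length := by
  cases l with
  | nil => exact Nat.one_pos
  | cons y l => rw [rowInsert]; split_ifs <;> exact Nat.succ_pos _

theorem NoEmptyRow.insertRows {T : SkewFilling} (h : T.NoEmptyRow) (x : ℕ) :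
    (insertRows x T).NoEmptyRow := by
  induction T generalizing x with
  | nil => simp [SkewFilling.insertRows, NoEmptyRow]
  | cons r T ih =>
    have hl := length_rowInsert_pos x r.2
    obtain ⟨-, hT⟩ := List.forall_mem_cons.1 h
    rw [SkewFilling.insertRows]
    rcases hr : rowInsert x r.2 with ⟨l', - | y⟩ <;> rw [hr] at hl
    · exact List.forall_mem_cons.2 ⟨Nat.add_pos_right _ hl, hT⟩
    · exact List.forall_mem_cons.2 ⟨Nat.add_pos_right _ hl, ih hT y⟩

theorem NoEmptyRow.vacate {T : SkewFilling} (h : T.NoEmptyRow) (i : ℕ) :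
    (vacate i T).NoEmptyRow := by
  induction i generalizing T with
  | zero =>
    rcases T with - | ⟨⟨m, - | ⟨x, l⟩⟩, T⟩
    · simp [SkewFilling.vacate, NoEmptyRow]
    · exact List.forall_mem_cons.2 ⟨Nat.succ_pos _, (List.forall_mem_cons.1 h).2⟩
    · exact List.forall_mem_cons.2 ⟨Nat.add_pos_left m.succ_pos _,
        NoEmptyRow.insertRows (List.forall_mem_cons.1 h).2 x⟩
  | succ i ih =>
    rcases T with - | ⟨r, T⟩
    · exact h
    · obtain ⟨hr, hT⟩ := List.forall_mem_cons.1 h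
      exact List.forall_mem_cons.2 ⟨hr, ih hT⟩

theorem IsInnerCorner.le_length {T : SkewFilling} {i j : ℕ} (h : T.IsInnerCorner i j) :
    i ≤ T.length := by
  rcases h.2 with rfl | h
  · exact Nat.zero_le _
  · by_contra! hi
    rw [inner_of_length_le (Nat.le_sub_one_of_lt hi)] at h
    exact h.not_ge (Nat.zero_le _)

theorem inner_of_internalInsert_eq_some {T P : SkewFilling} {c : ℕ × ℕ}
    (h : T.internalInsert c = some P) : P.inner = addBox T.inner c.1 := by
  unfold internalInsert at h
  split_ifs at h with hc
  obtain rfl := Option.some.inj h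
  exact inner_vacate hc.le_length

/-! ### Knuth commutativity -/

theorem IsStandardReading.exists_phi {T : SkewFilling} {t : List (ℕ × ℕ)}
    (h : T.IsStandardReading t) {i : ℕ} (hi : Antitone (addBox T.inner i)) :
    ∃ P, phi i T = some P ∧ P.inner = addBox T.inner i ∧
      P.IsStandardReading (phiReading i t) := by
  have hc : T.IsInnerCorner i (T.inner i) := ⟨rfl, (antitone_addBox_iff h.lattice.antitone).1 hi⟩
  have hinner := inner_vacate hc.le_length
  refine ⟨vacate i T, if_pos hc, hinner, ?_, pairwise_phiReading h.sorted i, ?_, ?_,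
    h.noEmptyRow.vacate i⟩
  · have hT : LabelsFrom 0 T t := fun j => by rw [zero_add, h.labels_eq]
    simpa only [LabelsFrom, zero_add] using labelsFrom_vacate hT h.sorted hc.le_length
  · exact hinner ▸ h.lattice.phiReading hi
  · rw [← List.forall_mem_map (f := Prod.fst) (P := (0 < ·)), map_fst_phiReading,
      List.forall_mem_map]
    exact h.pos

theorem IsStandardReading.exists_phiWord {T : SkewFilling} {t : List (ℕ × ℕ)}
    (h : T.IsStandardReading t) {u : List ℕ} (hu : IsLattice T.inner u.reverse) :
    ∃ P, phiWord u T = some P ∧ P.inner = u.reverse.foldl addBox T.inner ∧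
      P.IsStandardReading (phiWordReading u t) := by
  induction u with
  | nil => exact ⟨T, rfl, rfl, h⟩
  | cons a u ih =>
    rw [List.reverse_cons, isLattice_append, isLattice_cons] at hu
    obtain ⟨P, hP, hPinner, hPt⟩ := ih hu.1
    obtain ⟨Q, hQ, hQinner, hQt⟩ := hPt.exists_phi (hPinner ▸ hu.2.2.antitone)
    refine ⟨Q, by rw [phiWord, hP, Option.bind_some, hQ], ?_, hQt⟩
    rw [hQinner, hPinner, List.reverse_cons, List.foldl_append, List.foldl_cons, List.foldl_nil]

theorem IsSSYT.phiWord_eq_of_knuthEquiv {T : SkewFilling} (hT : T.IsSSYT) {u v : List ℕ}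
    (hu : IsLattice T.inner u.reverse) (h : KnuthEquiv v u) :
    ∃ P : SkewFilling, P.IsSSYT ∧ phiWord u T = some P ∧ phiWord v T = some P := by
  have hv := (h.isLattice_reverse_iff T.inner).2 hu
  obtain ⟨P, hP, hPinner, hPt⟩ := hT.isStandardReading.exists_phiWord hu
  obtain ⟨Q, hQ, hQinner, hQt⟩ := hT.isStandardReading.exists_phiWord hv
  have hinner : Q.inner = P.inner := by
    funext i
    rw [hPinner, hQinner, foldl_addBox_apply, foldl_addBox_apply, List.count_reverse,
      List.count_reverse, h.perm.count_eq]
  have hlabels : Q.labels = P.labels := by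
    funext i
    rw [hQt.labels_eq, hPt.labels_eq, h.phiWordReading_eq]
  obtain rfl := hQt.noEmptyRow.ext hPt.noEmptyRow hinner hlabels
  exact ⟨Q, hPt.isSSYT, hP, hQ⟩

theorem phiWord_append (u v : List ℕ) (T : SkewFilling) :
    phiWord (u ++ v) T = (phiWord v T).bind (phiWord u) := by
  induction u with
  | nil => exact (Option.bind_fun_some _).symm
  | cons a u ih =>
    rw [List.cons_append, phiWord, ih, Option.bind_assoc]
    rfl

theorem foldlM_internalInsert {T : SkewFilling} {L : List (ℕ × ℕ)}
    (h : ∀ a c b, L = a ++ c :: b → c.2 = T.inner c.1 + (a.map Prod.fst).count c.1) :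
    L.foldlM internalInsert T = phiWord (L.map Prod.fst).reverse T := by
  induction L generalizing T with
  | nil => rfl
  | cons c L ih =>
    obtain ⟨i, j⟩ := c
    obtain rfl : j = T.inner i := h [] _ _ rfl
    rw [List.foldlM_cons, List.map_cons, List.reverse_cons, phiWord_append]
    change _ = (T.internalInsert (i, T.inner i)).bind _
    rcases hP : T.internalInsert (i, T.inner i) with - | P
    · rfl
    · refine ih fun a c b hab => ?_
      rw [h ((i, T.inner i) :: a) c b (by rw [hab, List.cons_append]),
        inner_of_internalInsert_eq_some hP, ← foldl_addBox_apply, ← foldl_addBox_apply,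
        List.map_cons, List.foldl_cons]

theorem skewRSKP_eq_phiWord {T U : SkewFilling} (hU : U.IsSSYT) (h : T.SameInner U) :
    skewRSKP T U = phiWord U.companionWord T :=
  foldlM_internalInsert fun a c b hab => by rw [h, hU.snd_eq_of_standardOrder_eq hab]

end SkewFilling

theorem theorem4p3 (T : SkewFilling) (hT : T.IsSSYT) :
    (∀ u v : List ℕ, T.IsInternalInsertionOrderWord u → KnuthEquiv v u →
      T.IsInternalInsertionOrderWord v ∧
      ∃ P : SkewFilling, P.IsSSYT ∧
        SkewFilling.phiWord u T = some P ∧ SkewFilling.phiWord v T = some P) ∧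
    (∀ U V : SkewFilling, U.IsSSYT → V.IsSSYT → T.SameInner U → T.SameInner V →
      KnuthEquiv U.companionWord V.companionWord →
      ∃ P : SkewFilling, P.IsSSYT ∧
        SkewFilling.skewRSKP T U = some P ∧ SkewFilling.skewRSKP T V = some P) := by
  have key (u v : List ℕ) (hu : T.IsInternalInsertionOrderWord u) (h : KnuthEquiv v u) :
      T.IsInternalInsertionOrderWord v ∧ ∃ P : SkewFilling, P.IsSSYT ∧
        SkewFilling.phiWord u T = some P ∧ SkewFilling.phiWord v T = some P := by
    rw [SkewFilling.isInternalInsertionOrderWord_iff] at hu ⊢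
    exact ⟨(h.isLattice_reverse_iff T.inner).2 hu, hT.phiWord_eq_of_knuthEquiv hu h⟩
  refine ⟨key, fun U V hU hV hTU hTV h => ?_⟩
  obtain ⟨-, P, hP, hVP, hUP⟩ := key _ _ ⟨V, hV, hTV, rfl⟩ h
  rw [SkewFilling.skewRSKP_eq_phiWord hU hTU, SkewFilling.skewRSKP_eq_phiWord hV hTV]
  exact ⟨P, hP, hUP, hVP⟩
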